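/- Let $d,N\in\mathbb N$ and $T>0$, and let $\mathcal P_2(X)$ denote the Borel probability measures with finite second moment on a Euclidean space $X$, with the 2-Wasserstein distance $W_2$. Let $\lambda:\mathcal P_2(\mathbb R^d)\to(0,\infty)$ be bounded and $W_2$-continuous. For $\mu\in\mathcal P_2((\mathbb R^d)^N)$ let $\mu^i=(p_i)_\#\mu$ be its $i$-th marginal, let $$\mathrm{Bar}(\mu)=\operatorname*{argmin}_{\nu\in\mathcal P_2(\mathbb R^d)}\ \sum_{i=1}^N\lambda(\mu^i)\,W_2^2(\mu^i,\nu)$$ be the set of weighted Wasserstein barycenters, and let $$\mathcal V[\mu]=\Big\{\bigotimes_{i=1}^N(\pi_0,\pi_1-\pi_0)_\#\gamma^i\ :\ \gamma^i\text{ is a } W_2\text{-optimal plan between }\mu^i\text{ and some }\nu^i\in\mathrm{Bar}(\mu),\ i=1,\dots,N\Big\},$$ where $\pi_0(x,y)=x$, $\pi_1(x,y)=y$, and the product is regarded as a probability measure on $T(\mathbb R^d)^N=(\mathbb R^d)^N\times(\mathbb R^d)^N$ (base points and velocities). Let $\mathrm{Sol}[\mathcal V]$ be the set of solutions on $[0,T]$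 of the consensus measure differential inclusion $\dot\mu_t\in\mathcal V[\mu_t]$, that is, of all curves $\mu\in C([0,T],(\mathcal P_2((\mathbb R^d)^N),W_2))$ such that for every $\varphi\in C_c^\infty((\mathbb R^d)^N)$ the function $t\mapsto\int\varphi\,d\mu_t$ is absolutely continuous on $[0,T]$ and, for almost every $t\in[0,T]$, $$\frac{d}{dt}\int\varphi\,d\mu_t\in\Big\{\int v\cdot\nabla\varphi(x)\,W(dx,dv)\ :\ W\in\mathcal V[\mu_t]\Big\}.$$ Then $\mathrm{Sol}[\mathcal V]$ is closed under uniform $W_2$-convergence: if $\mu^n\in\mathrm{Sol}[\mathcal V]$ for all $n$ and $\mu:[0,T]\to\mathcal P_2((\mathbb R^d)^N)$ satisfies $\sup_{t\in[0,T]}W_2(\mu^n_t,\mu_t)\to0$, then $\mu\in\mathrm{Sol}[\mathcal V]$. Moreover, if all the curves $\mu^n$ are Lipschitz on $[0,T]$ with respect to $W_2$ with a common constant $L$, then so is $\mu$. -/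

import Mathlib

open MeasureTheory Filter Topology Set
open scoped ENNReal ContDiff

namespace ConsensusMDI

/-- Probability measures with finite second moment on a normed space `X`. The class carries no
topology of its own: all convergence below is with respect to the Wasserstein distance `W2`. -/
structure P2 (X : Type*) [NormedAddCommGroup X] [MeasurableSpace X] where
  /-- the underlying measure -/
  toMeasure : Measure X
  isProb : IsProbabilityMeasure toMeasure
  moment : ∫⁻ x, ‖x‖ₑ ^ 2 ∂toMeasure < ⊤

attribute [instance] P2.isProb

section Wasserstein

variable {X : Type*} [NormedAddCommGroup X] [MeasurableSpace X]

/-- The transport plans between `μ` and `ν`: measures on `X × X` with marginals `μ` and `ν`.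
They are probability measures because `μ` is one. -/
def couplings (μ ν : P2 X) : Set (Measure (X × X)) :=
  {γ | γ.fst = μ.toMeasure ∧ γ.snd = ν.toMeasure}

/-- The quadratic cost of a transport plan. -/
noncomputable def cost (γ : Measure (X × X)) : ℝ≥0∞ :=
  ∫⁻ p, ‖p.1 - p.2‖ₑ ^ 2 ∂γ

/-- The squared 2-Wasserstein distance. -/
noncomputable def W2sq (μ ν : P2 X) : ℝ≥0∞ :=
  ⨅ γ ∈ couplings μ ν, cost γ

/-- The 2-Wasserstein distance (it is finite on `P2 X`). -/
noncomputable def W2 (μ ν : P2 X) : ℝ≥0∞ :=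
  W2sq μ ν ^ (1 / 2 : ℝ)

/-- The optimal transport plans between `μ` and `ν`. -/
def optCouplings (μ ν : P2 X) : Set (Measure (X × X)) :=
  {γ | γ ∈ couplings μ ν ∧ cost γ = W2sq μ ν}

/-- Continuity of a real function on the metric space `(P2 X, W2)`. -/
def W2Continuous (f : P2 X → ℝ) : Prop :=
  ∀ (u : ℕ → P2 X) (m : P2 X), Tendsto (fun n => W2 (u n) m) atTop (𝓝 0) →
    Tendsto (fun n => f (u n)) atTop (𝓝 (f m))

/-- Continuity on `[0, T]` of a curve in the metric space `(P2 X, W2)`. -/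
def W2ContinuousOn (T : ℝ) (μ : ℝ → P2 X) : Prop :=
  ∀ s ∈ Icc 0 T, Tendsto (fun t => W2 (μ t) (μ s)) (𝓝[Icc 0 T] s) (𝓝 0)

/-- Lipschitz continuity on `[0, T]`, with constant `L`, of a curve in `(P2 X, W2)`. -/
def W2LipschitzOn (L : NNReal) (T : ℝ) (μ : ℝ → P2 X) : Prop :=
  ∀ s ∈ Icc 0 T, ∀ t ∈ Icc 0 T, W2 (μ s) (μ t) ≤ L * edist s t

end Wasserstein

/-- `ℝᵈ` with the Euclidean norm. -/
abbrev Space (d : ℕ) : Type := EuclideanSpace ℝ (Fin d)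

/-- `(ℝᵈ)ᴺ` with the Euclidean norm. -/
abbrev Ensemble (d N : ℕ) : Type := PiLp 2 (fun _ : Fin N => Space d)

variable {d N : ℕ}

/-- The `i`-th agent `μⁱ = (pᵢ)_# μ` of an ensemble measure `μ` on `(ℝᵈ)ᴺ`. -/
noncomputable def agent (μ : P2 (Ensemble d N)) (i : Fin N) : P2 (Space d) where
  toMeasure := μ.toMeasure.map (fun x => x i)
  isProb := Measure.isProbabilityMeasure_map (by fun_prop)
  moment := by
    rw [lintegral_map (by fun_prop) (by fun_prop)]
    refine lt_of_le_of_lt (lintegral_mono fun x => ?_) μ.moment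
    have h : ‖x i‖ₑ ≤ ‖x‖ₑ := by
      rw [enorm_le_iff_norm_le]
      exact PiLp.norm_apply_le x i
    gcongr

/-- The barycenter functional `ν ↦ ∑ᵢ λ(μⁱ) W₂²(μⁱ, ν)`. -/
noncomputable def barFunctional (lam : P2 (Space d) → ℝ) (μ : P2 (Ensemble d N))
    (ν : P2 (Space d)) : ℝ≥0∞ :=
  ∑ i, ENNReal.ofReal (lam (agent μ i)) * W2sq (agent μ i) ν

/-- The set of weighted Wasserstein barycenters of the agents of `μ`. -/
def Bar (lam : P2 (Space d) → ℝ) (μ : P2 (Ensemble d N)) : Set (P2 (Space d)) :=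
  {ν | ∀ ν', barFunctional lam μ ν ≤ barFunctional lam μ ν'}

/-- The product `⨂ᵢ Vⁱ` of measures on the tangent bundle `Tℝᵈ = ℝᵈ × ℝᵈ`, seen as a measure on
`T(ℝᵈ)ᴺ = (ℝᵈ)ᴺ × (ℝᵈ)ᴺ` (base points first, velocities second). -/
noncomputable def tensor (V : Fin N → Measure (Space d × Space d)) :
    Measure (Ensemble d N × Ensemble d N) :=
  (Measure.pi V).map
    (fun z => (WithLp.toLp 2 (fun i => (z i).1), WithLp.toLp 2 (fun i => (z i).2)))

/-- The multivalued vector field `𝒱[μ] = ⨂ᵢ (π₀, π₁ - π₀)_# Γₒ(μⁱ, Bar)`. Different agents may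
use different barycenters. -/
def field (lam : P2 (Space d) → ℝ) (μ : P2 (Ensemble d N)) :
    Set (Measure (Ensemble d N × Ensemble d N)) :=
  {W | ∃ γ : Fin N → Measure (Space d × Space d),
    (∀ i, ∃ ν ∈ Bar lam μ, γ i ∈ optCouplings (agent μ i) ν) ∧
      W = tensor (fun i => (γ i).map (fun p => (p.1, p.2 - p.1)))}

/-- The pairing `⟨∇φ, W⟩ = ∫ v · ∇φ(x) W(dx, dv)`; here `v · ∇φ(x)` is the derivative of `φ` at
`x` in the direction `v`. -/
noncomputable def gradPairing (φ : Ensemble d N → ℝ)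
    (W : Measure (Ensemble d N × Ensemble d N)) : ℝ :=
  ∫ p, fderiv ℝ φ p.1 p.2 ∂W

/-- The solutions on `[0, T]` of the measure differential inclusion `μ̇ₜ ∈ 𝒱[μₜ]`: the curves in
`C([0, T], P₂((ℝᵈ)ᴺ))` such that, for each test function `φ`, the function `t ↦ ∫ φ dμₜ` is
absolutely continuous on `[0, T]` (so that it is the integral of its derivative) and its
derivative lies in `{⟨∇φ, W⟩ : W ∈ 𝒱[μₜ]}` for almost every `t`. Only the values of the curve on
`[0, T]` matter. -/
def Sol (lam : P2 (Space d) → ℝ) (T : ℝ) : Set (ℝ → P2 (Ensemble d N)) :=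
  {μ | W2ContinuousOn T μ ∧
    ∀ φ : Ensemble d N → ℝ, ContDiff ℝ ∞ φ → HasCompactSupport φ →
      AbsolutelyContinuousOnInterval (fun t => ∫ x, φ x ∂(μ t).toMeasure) 0 T ∧
      ∀ᵐ t ∂(volume.restrict (Icc 0 T)), ∃ W ∈ field lam (μ t),
        HasDerivWithinAt (fun s => ∫ x, φ x ∂(μ s).toMeasure) (gradPairing φ W) (Icc 0 T) t}

end ConsensusMDI

/-!
Fix a test function `φ` and let `F μ = {⟨∇φ, W⟩ : W ∈ 𝒱[μ]}`. The optimal plans from an agent to a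
barycenter form a weakly compact set, connected because it is stable under mixtures, and this set
depends upper hemicontinuously on `μ`. As `⟨∇φ, ⨂ᵢ (π₀, π₁ - π₀)_# γⁱ⟩` is continuous in the plans
of bounded cost, `F μ` is a compact interval depending upper hemicontinuously on `μ`.

The difference quotients of an absolutely continuous function are averages of its derivative, so
near `t` and for large `n` those of `s ↦ ∫ φ dμⁿₛ` stay in any given closed convex neighbourhood of
the interval `F (μ t)`. They converge to those of `s ↦ ∫ φ dμₛ`, which is therefore Lipschitz, with
derivative in `F (μ t)` wherever that exists.
-/

namespace ConsensusMDI

section WeakConvergence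

lemma isTightMeasureSet_lintegral_enorm_le {E : Type*} [NormedAddCommGroup E] [ProperSpace E]
    [MeasurableSpace E] [BorelSpace E] {B : ℝ≥0∞} (hB : B ≠ ⊤) :
    IsTightMeasureSet {μ : Measure E | ∫⁻ x, ‖x‖ₑ ∂μ ≤ B} := by
  refine isTightMeasureSet_of_tendsto_measure_norm_gt ?_
  have hlim : Tendsto (fun r : ℝ => B / ENNReal.ofReal r) atTop (𝓝 0) :=
    ENNReal.div_top (a := B) ▸ ENNReal.Tendsto.const_div ENNReal.tendsto_ofReal_atTop (Or.inr hB)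
  refine tendsto_of_tendsto_of_tendsto_of_le_of_le' tendsto_const_nhds hlim
    (Eventually.of_forall fun _ => zero_le) ?_
  filter_upwards [eventually_gt_atTop 0] with r hr
  refine iSup₂_le fun μ hμ => ?_
  calc μ {x | r < ‖x‖} ≤ μ {x | ENNReal.ofReal r ≤ ‖x‖ₑ} := by
        refine measure_mono fun x (hx : r < ‖x‖) => ?_
        simpa only [mem_ofPred_eq, ← ofReal_norm] using ENNReal.ofReal_le_ofReal hx.le
    _ ≤ (∫⁻ x, ‖x‖ₑ ∂μ) / ENNReal.ofReal r :=
        meas_ge_le_lintegral_div (by fun_prop) (by simpa using hr) (by simp)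
    _ ≤ B / ENNReal.ofReal r := by
        gcongr

lemma isTightMeasureSet_fst_snd_mem {X Y : Type*} [MeasurableSpace X] [TopologicalSpace X]
    [MeasurableSpace Y] [TopologicalSpace Y] {S : Set (Measure X)} {T : Set (Measure Y)}
    (hS : IsTightMeasureSet S) (hT : IsTightMeasureSet T) :
    IsTightMeasureSet {γ : Measure (X × Y) | γ.fst ∈ S ∧ γ.snd ∈ T} :=
  .prodMk (hS.subset (image_subset_iff.2 fun _ hγ => hγ.1))
    (hT.subset (image_subset_iff.2 fun _ hγ => hγ.2))

lemma exists_tendsto_of_isTightMeasureSet {E ι : Type*} [MeasurableSpace E] [TopologicalSpace E]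
    [T2Space E] [BorelSpace E] {S : Set (Measure E)} (hS : IsTightMeasureSet S) (𝒰 : Ultrafilter ι)
    {P : ι → ProbabilityMeasure E} (hP : ∀ᶠ i in 𝒰, (P i : Measure E) ∈ S) :
    ∃ P₀, Tendsto P 𝒰 (𝓝 P₀) := by
  have hcompact : IsCompact (closure {Q : ProbabilityMeasure E | (Q : Measure E) ∈ S}) :=
    isCompact_closure_of_isTightMeasureSet (hS.subset fun _ ⟨_, h, e⟩ => e ▸ h)
  obtain ⟨P₀, -, h₀⟩ := hcompact.ultrafilter_le_nhds (𝒰.map P)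
    (le_principal_iff.2 (mem_of_superset hP fun _ h => subset_closure h))
  exact ⟨P₀, h₀⟩

lemma eLpNorm_two_lt_top_iff {α E : Type*} [MeasurableSpace α] [NormedAddCommGroup E]
    {μ : Measure α} {f : α → E} : eLpNorm f 2 μ < ⊤ ↔ ∫⁻ x, ‖f x‖ₑ ^ 2 ∂μ < ⊤ := by
  simpa using eLpNorm_lt_top_iff_lintegral_rpow_enorm_lt_top (f := f) (μ := μ) two_ne_zero
    ENNReal.ofNat_ne_top

variable {Ω : Type*} [MeasurableSpace Ω] [TopologicalSpace Ω] [OpensMeasurableSpace Ω]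

lemma lowerSemicontinuous_lintegral {f : Ω → ℝ≥0∞} (hf : Continuous f) :
    LowerSemicontinuous fun P : ProbabilityMeasure Ω => ∫⁻ x, f x ∂(P : Measure Ω) := by
  have htrunc (n : ℕ) :
      Continuous fun P : ProbabilityMeasure Ω => ∫⁻ x, min (f x) n ∂(P : Measure Ω) := by
    have hfin (x : Ω) : min (f x) n ≠ ⊤ := ((min_le_right _ _).trans_lt (by simp)).ne
    let g : BoundedContinuousFunction Ω NNReal := .mkOfBound
      ⟨fun x => (min (f x) n).toNNReal, ENNReal.continuousOn_toNNReal.comp_continuous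
        (hf.min continuous_const) hfin⟩ n fun x y => by
          have hle (z : Ω) : ((min (f z) n).toNNReal : ℝ) ≤ n :=
            ENNReal.toReal_le_of_le_ofReal (by simp) (by simp)
          exact abs_sub_le_of_nonneg_of_le NNReal.zero_le_coe (hle x) NNReal.zero_le_coe (hle y)
    simp_rw [← show ∀ x, (g x : ℝ≥0∞) = min (f x) n from fun x => ENNReal.coe_toNNReal (hfin x)]
    exact continuous_iff_continuousAt.2 fun P =>
      ProbabilityMeasure.tendsto_iff_forall_lintegral_tendsto.1 tendsto_id g
  have hsup (P : ProbabilityMeasure Ω) :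
      ∫⁻ x, f x ∂(P : Measure Ω) = ⨆ n : ℕ, ∫⁻ x, min (f x) n ∂(P : Measure Ω) := by
    rw [← lintegral_iSup (fun n => by fun_prop) fun m n hmn x => by dsimp; gcongr]
    simp_rw [← inf_iSup_eq, ENNReal.iSup_natCast, inf_top_eq]
  simp_rw [hsup]
  exact lowerSemicontinuous_iSup fun n => (htrunc n).lowerSemicontinuous

lemma abs_div_one_add_mul_abs_le {δ : ℝ} (hδ : 0 < δ) (a : ℝ) : |a / (1 + δ * |a|)| ≤ δ⁻¹ := by
  have h : 0 < 1 + δ * |a| := by positivity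
  rw [abs_div, abs_of_pos h, div_le_iff₀ h, mul_add, inv_mul_cancel_left₀ hδ.ne']
  linarith [inv_pos.2 hδ]

lemma abs_sub_div_one_add_mul_abs_le {δ : ℝ} (hδ : 0 < δ) (a : ℝ) :
    |a - a / (1 + δ * |a|)| ≤ δ * a ^ 2 := by
  have h : 0 < 1 + δ * |a| := by positivity
  calc |a - a / (1 + δ * |a|)| = δ * |a| ^ 2 / (1 + δ * |a|) := by
        rw [show a - a / (1 + δ * |a|) = a * (δ * |a|) / (1 + δ * |a|) by field_simp; ring,
          abs_div, abs_of_pos h, abs_mul, abs_of_nonneg (by positivity : 0 ≤ δ * |a|)]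
        ring
    _ ≤ δ * |a| ^ 2 :=
        div_le_self (by positivity) (le_add_of_nonneg_right (by positivity))
    _ = δ * a ^ 2 := by rw [sq_abs]

lemma continuousOn_integral_of_lintegral_sq_le {g : Ω → ℝ} (hg : Continuous g) {B : ℝ≥0∞}
    (hB : B ≠ ⊤) :
    ContinuousOn (fun P : ProbabilityMeasure Ω => ∫ x, g x ∂(P : Measure Ω))
      {P | ∫⁻ x, ‖g x‖ₑ ^ 2 ∂(P : Measure Ω) ≤ B} := by
  -- `gδ δ` is bounded and, by the second moment bound, `∫ gδ δ → ∫ g` uniformly as `δ → 0`.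
  let gδ (δ : ℝ) (x : Ω) : ℝ := g x / (1 + δ * |g x|)
  have hcont {δ : ℝ} (hδ : 0 < δ) : Continuous (gδ δ) :=
    hg.div (by fun_prop) fun x => by positivity
  have hbound {δ : ℝ} (hδ : 0 < δ) (x : Ω) : ‖gδ δ x‖ ≤ δ⁻¹ :=
    abs_div_one_add_mul_abs_le hδ (g x)
  have herr {δ : ℝ} (hδ : 0 < δ) (x : Ω) : ‖g x - gδ δ x‖ₑ ≤ ENNReal.ofReal δ * ‖g x‖ₑ ^ 2 := by
    rw [← ofReal_norm, ← ofReal_norm, ← ENNReal.ofReal_pow (norm_nonneg _),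
      ← ENNReal.ofReal_mul hδ.le, Real.norm_eq_abs (g x), sq_abs]
    exact ENNReal.ofReal_le_ofReal (abs_sub_div_one_add_mul_abs_le hδ (g x))
  refine TendstoUniformlyOn.continuousOn (p := 𝓝[>] 0)
    (F := fun δ (P : ProbabilityMeasure Ω) => ∫ x, gδ δ x ∂(P : Measure Ω))
    (EMetric.tendstoUniformlyOn_iff.2 fun ε hε => ?_) ?_
  · have hlim : Tendsto (fun δ : ℝ => ENNReal.ofReal δ * B) (𝓝[>] 0) (𝓝 0) := by
      have h : Tendsto ENNReal.ofReal (𝓝[>] 0) (𝓝 0) :=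
        (ENNReal.continuous_ofReal.tendsto' 0 0 (by simp)).mono_left inf_le_left
      simpa using ENNReal.Tendsto.mul_const h (Or.inr hB)
    filter_upwards [hlim.eventually_lt_const hε, self_mem_nhdsWithin] with δ hδε hδ P hP
    have hgP : Integrable g (P : Measure Ω) := MemLp.integrable one_le_two
      ⟨hg.aestronglyMeasurable, eLpNorm_two_lt_top_iff.2 (hP.trans_lt hB.lt_top)⟩
    have hδP : Integrable (gδ δ) (P : Measure Ω) :=
      .of_bound (hcont hδ).aestronglyMeasurable _ (.of_forall (hbound hδ))
    calc edist (∫ x, g x ∂(P : Measure Ω)) (∫ x, gδ δ x ∂(P : Measure Ω))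
        = ‖∫ x, g x - gδ δ x ∂(P : Measure Ω)‖ₑ := by
          rw [integral_sub hgP hδP, edist_eq_enorm_sub]
      _ ≤ ∫⁻ x, ENNReal.ofReal δ * ‖g x‖ₑ ^ 2 ∂(P : Measure Ω) :=
          (enorm_integral_le_lintegral_enorm _).trans (lintegral_mono (herr hδ))
      _ ≤ ENNReal.ofReal δ * B := by
          rw [lintegral_const_mul _ (by fun_prop)]
          gcongr
      _ < ε := hδε
  · refine (eventually_mem_nhdsWithin.mono fun δ hδ => Continuous.continuousOn ?_).frequently
    exact continuous_iff_continuousAt.2 fun P =>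
      ProbabilityMeasure.tendsto_iff_forall_integral_tendsto.1 tendsto_id
        (.ofNormedAddCommGroup (gδ δ) (hcont hδ) δ⁻¹ (hbound hδ))

lemma isPreconnected_of_forall_mixture_mem {S : Set (ProbabilityMeasure Ω)}
    (hS : ∀ P ∈ S, ∀ Q ∈ S, ∀ R : ProbabilityMeasure Ω, ∀ a b : NNReal, a + b = 1 →
      (R : Measure Ω) = a • (P : Measure Ω) + b • (Q : Measure Ω) → R ∈ S) :
    IsPreconnected S := by
  refine isPreconnected_of_forall_pair fun P hP Q hQ => ?_
  let b (t : unitInterval) : NNReal := ⟨t, t.2.1⟩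
  let R (t : unitInterval) : FiniteMeasure Ω :=
    b (unitInterval.symm t) • P.toFiniteMeasure + b t • Q.toFiniteMeasure
  have hb (t : unitInterval) : b (unitInterval.symm t) + b t = 1 :=
    Subtype.ext (sub_add_cancel 1 (t : ℝ))
  have hR (t : unitInterval) : IsProbabilityMeasure (R t : Measure Ω) := ⟨by
    change (b (unitInterval.symm t) • (P : Measure Ω) + b t • (Q : Measure Ω)) univ = 1
    simpa using Convex.combo_self (hb t) (1 : ℝ≥0∞)⟩
  let path (t : unitInterval) : ProbabilityMeasure Ω := ⟨R t, hR t⟩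
  have hpath : Continuous path := by
    rw [(ProbabilityMeasure.toFiniteMeasure_isEmbedding Ω).continuous_iff]
    change Continuous R
    fun_prop
  refine ⟨range path, ?_, ⟨0, ?_⟩, ⟨1, ?_⟩, isPreconnected_range hpath⟩
  · rintro _ ⟨t, rfl⟩
    exact hS P hP Q hQ _ _ _ (hb t) rfl
  · exact Subtype.ext (by simp [path, R, show b 0 = 0 from rfl, show b 1 = 1 from rfl])
  · exact Subtype.ext (by simp [path, R, show b 0 = 0 from rfl, show b 1 = 1 from rfl])

end WeakConvergence

section OptimalPlans

variable {X : Type*} [NormedAddCommGroup X] [MeasurableSpace X] {μ ν : P2 X} {γ : Measure (X × X)}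

lemma isProbabilityMeasure_of_mem_couplings (hγ : γ ∈ couplings μ ν) : IsProbabilityMeasure γ :=
  ⟨by rw [← Measure.fst_univ, hγ.1, measure_univ]⟩

lemma prod_mem_couplings (μ ν : P2 X) : μ.toMeasure.prod ν.toMeasure ∈ couplings μ ν :=
  ⟨by simp, by simp⟩

lemma W2sq_le_cost (hγ : γ ∈ couplings μ ν) : W2sq μ ν ≤ cost γ :=
  iInf₂_le γ hγ

lemma cost_rpow_half (γ : Measure (X × X)) :
    cost γ ^ (1 / 2 : ℝ) = eLpNorm (fun p : X × X => p.1 - p.2) 2 γ := by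
  simp [eLpNorm_eq_lintegral_rpow_enorm_toReal, cost]

lemma W2_le_eLpNorm (hγ : γ ∈ couplings μ ν) : W2 μ ν ≤ eLpNorm (fun p => p.1 - p.2) 2 γ :=
  cost_rpow_half γ ▸ ENNReal.rpow_le_rpow (W2sq_le_cost hγ) (by positivity)

lemma W2_eq_eLpNorm (hγ : γ ∈ optCouplings μ ν) : W2 μ ν = eLpNorm (fun p => p.1 - p.2) 2 γ := by
  rw [W2, ← hγ.2, cost_rpow_half]

lemma W2_sq (μ ν : P2 X) : W2 μ ν ^ 2 = W2sq μ ν := by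
  rw [W2, ← ENNReal.rpow_two, ← ENNReal.rpow_mul]
  norm_num

/-- The element of `ProbabilityMeasure X`, which carries the weak topology, underlying `μ`. -/
def P2.toProb (μ : P2 X) : ProbabilityMeasure X := ⟨μ.toMeasure, μ.isProb⟩

lemma P2.eLpNorm_id_lt_top (μ : P2 X) : eLpNorm id 2 μ.toMeasure < ⊤ :=
  eLpNorm_two_lt_top_iff.2 μ.moment

lemma measurePreserving_fst_of_mem_couplings (hγ : γ ∈ couplings μ ν) :
    MeasurePreserving Prod.fst γ μ.toMeasure :=
  ⟨measurable_fst, hγ.1⟩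

lemma measurePreserving_snd_of_mem_couplings (hγ : γ ∈ couplings μ ν) :
    MeasurePreserving Prod.snd γ ν.toMeasure :=
  ⟨measurable_snd, hγ.2⟩

variable [BorelSpace X]

lemma map_eq_toMeasure_of_tendsto {Ω ι : Type*} [MeasurableSpace Ω] [TopologicalSpace Ω]
    [OpensMeasurableSpace Ω] {f : Ω → X} (hf : Continuous f) {l : Filter ι} [l.NeBot]
    {P : ι → ProbabilityMeasure Ω} {P₀ : ProbabilityMeasure Ω} (hP : Tendsto P l (𝓝 P₀))
    {m : ι → P2 X} (hm : Tendsto (fun i => (m i).toProb) l (𝓝 μ.toProb))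
    (h : ∀ᶠ i in l, (P i : Measure Ω).map f = (m i).toMeasure) :
    (P₀ : Measure Ω).map f = μ.toMeasure :=
  have hmap := ((ProbabilityMeasure.continuous_map hf).tendsto P₀).comp hP
  congrArg ProbabilityMeasure.toMeasure (tendsto_nhds_unique hmap
    (hm.congr' (h.mono fun _ hi => Subtype.ext hi.symm)))

variable [SecondCountableTopology X]

lemma W2_le_eLpNorm_id_add (μ ν : P2 X) :
    W2 μ ν ≤ eLpNorm id 2 μ.toMeasure + eLpNorm id 2 ν.toMeasure := by
  have hγ := prod_mem_couplings μ ν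
  rw [← eLpNorm_comp_measurePreserving (by fun_prop) (measurePreserving_fst_of_mem_couplings hγ),
    ← eLpNorm_comp_measurePreserving (by fun_prop) (measurePreserving_snd_of_mem_couplings hγ)]
  exact (W2_le_eLpNorm hγ).trans (eLpNorm_sub_le (by fun_prop) (by fun_prop) one_le_two)

lemma eLpNorm_snd_le_add_eLpNorm_sub (γ : Measure (X × X)) :
    eLpNorm Prod.snd 2 γ ≤ eLpNorm Prod.fst 2 γ + eLpNorm (fun p => p.1 - p.2) 2 γ := by
  have h := eLpNorm_sub_le (f := Prod.fst) (g := fun p : X × X => p.1 - p.2) (μ := γ)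
    (by fun_prop) (by fun_prop) one_le_two
  rwa [show (Prod.fst - fun p : X × X => p.1 - p.2) = Prod.snd by ext; simp] at h

lemma W2sq_lt_top (μ ν : P2 X) : W2sq μ ν < ⊤ := by
  rw [← W2_sq]
  exact ENNReal.pow_lt_top ((W2_le_eLpNorm_id_add μ ν).trans_lt
    (ENNReal.add_lt_top.2 ⟨μ.eLpNorm_id_lt_top, ν.eLpNorm_id_lt_top⟩))

lemma exists_mem_couplings_of_cost_lt_top {γ : Measure (X × X)} (hfst : γ.fst = μ.toMeasure)
    (hcost : cost γ < ⊤) : ∃ ν : P2 X, γ ∈ couplings μ ν := by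
  have : IsProbabilityMeasure γ := ⟨by rw [← Measure.fst_univ, hfst, measure_univ]⟩
  have hsnd : MeasurePreserving Prod.snd γ γ.snd := ⟨measurable_snd, rfl⟩
  have hmoment : eLpNorm Prod.snd 2 γ < ⊤ := by
    refine (eLpNorm_snd_le_add_eLpNorm_sub γ).trans_lt (ENNReal.add_lt_top.2 ⟨?_, ?_⟩)
    · exact (eLpNorm_comp_measurePreserving (g := id) (by fun_prop)
        ⟨measurable_fst, hfst⟩).trans_lt μ.eLpNorm_id_lt_top
    · exact cost_rpow_half γ ▸ ENNReal.rpow_lt_top_of_nonneg (by positivity) hcost.ne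
  refine ⟨⟨γ.snd, inferInstance, ?_⟩, hfst, rfl⟩
  rw [← hsnd.lintegral_comp (by fun_prop)]
  exact eLpNorm_two_lt_top_iff.1 hmoment

lemma mem_couplings_of_tendsto {ι : Type*} {l : Filter ι} [l.NeBot] {m n : ι → P2 X}
    (hm : Tendsto (fun i => (m i).toProb) l (𝓝 μ.toProb))
    (hn : Tendsto (fun i => (n i).toProb) l (𝓝 ν.toProb))
    {γ : ι → ProbabilityMeasure (X × X)} {γ₀ : ProbabilityMeasure (X × X)}
    (hγ : Tendsto γ l (𝓝 γ₀)) (hmem : ∀ᶠ i in l, (γ i : Measure (X × X)) ∈ couplings (m i) (n i)) :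
    (γ₀ : Measure (X × X)) ∈ couplings μ ν :=
  ⟨map_eq_toMeasure_of_tendsto continuous_fst hγ hm (hmem.mono fun _ h => h.1),
    map_eq_toMeasure_of_tendsto continuous_snd hγ hn (hmem.mono fun _ h => h.2)⟩

lemma exists_mem_couplings_of_tendsto {ι : Type*} {l : Filter ι} [l.NeBot] {m n : ι → P2 X}
    (hm : Tendsto (fun i => (m i).toProb) l (𝓝 μ.toProb))
    {γ : ι → ProbabilityMeasure (X × X)} {γ₀ : ProbabilityMeasure (X × X)}
    (hγ : Tendsto γ l (𝓝 γ₀)) (hmem : ∀ᶠ i in l, (γ i : Measure (X × X)) ∈ couplings (m i) (n i))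
    (hcost : cost (γ₀ : Measure (X × X)) < ⊤) :
    ∃ ν : P2 X, (γ₀ : Measure (X × X)) ∈ couplings μ ν ∧
      Tendsto (fun i => (n i).toProb) l (𝓝 ν.toProb) := by
  obtain ⟨ν, hν⟩ := exists_mem_couplings_of_cost_lt_top
    (map_eq_toMeasure_of_tendsto continuous_fst hγ hm (hmem.mono fun _ h => h.1)) hcost
  have hsnd := ((ProbabilityMeasure.continuous_map continuous_snd).tendsto γ₀).comp hγ
  refine ⟨ν, hν, ?_⟩
  rw [show ν.toProb = γ₀.map continuous_snd.aemeasurable from Subtype.ext hν.2.symm]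
  exact hsnd.congr' (hmem.mono fun _ h => Subtype.ext h.2)

lemma lowerSemicontinuous_cost :
    LowerSemicontinuous fun γ : ProbabilityMeasure (X × X) => cost (γ : Measure (X × X)) :=
  lowerSemicontinuous_lintegral (by fun_prop)

lemma exists_mem_optCouplings [CompleteSpace X] (μ ν : P2 X) : ∃ γ, γ ∈ optCouplings μ ν := by
  let K : Set (ProbabilityMeasure (X × X)) := {γ | (γ : Measure (X × X)) ∈ couplings μ ν}
  have hK : IsCompact K := by
    have hsingle (ρ : P2 X) : IsTightMeasureSet {ρ.toMeasure} := isTightMeasureSet_singleton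
    have htight : IsTightMeasureSet (couplings μ ν) :=
      (isTightMeasureSet_fst_snd_mem (hsingle μ) (hsingle ν)).subset fun _ hγ => ⟨hγ.1, hγ.2⟩
    have hclosed : IsClosed K := isClosed_iff_ultrafilter.2 fun γ 𝒰 h𝒰 hK =>
      mem_couplings_of_tendsto tendsto_const_nhds tendsto_const_nhds h𝒰 hK
    refine IsCompact.of_isClosed_subset (isCompact_closure_of_isTightMeasureSet ?_) hclosed
      subset_closure
    exact htight.subset fun _ ⟨_, h, e⟩ => e ▸ h
  obtain ⟨γ, hγ, hmin⟩ := lowerSemicontinuous_cost.lowerSemicontinuousOn K |>.exists_isMinOn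
    ⟨⟨_, inferInstance⟩, prod_mem_couplings μ ν⟩ hK
  refine ⟨γ, hγ, le_antisymm (le_iInf₂ fun γ' hγ' => ?_) (W2sq_le_cost hγ)⟩
  exact hmin (a := ⟨γ', isProbabilityMeasure_of_mem_couplings hγ'⟩) hγ'

end OptimalPlans

section Mixtures

variable {X Y : Type*} [MeasurableSpace X] [MeasurableSpace Y]

lemma fst_smul_add_smul (a b : NNReal) (γ₀ γ₁ : Measure (X × Y)) :
    (a • γ₀ + b • γ₁).fst = a • γ₀.fst + b • γ₁.fst := by
  simp only [Measure.fst, Measure.map_add _ _ measurable_fst, Measure.map_smul]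

lemma snd_smul_add_smul (a b : NNReal) (γ₀ γ₁ : Measure (X × Y)) :
    (a • γ₀ + b • γ₁).snd = a • γ₀.snd + b • γ₁.snd := by
  simp only [Measure.snd, Measure.map_add _ _ measurable_snd, Measure.map_smul]

variable [NormedAddCommGroup X]

lemma cost_smul_add_smul (a b : NNReal) (γ₀ γ₁ : Measure (X × X)) :
    cost (a • γ₀ + b • γ₁) = a * cost γ₀ + b * cost γ₁ := by
  simp only [cost, lintegral_add_measure, lintegral_smul_measure, ENNReal.smul_def, smul_eq_mul]

end Mixtures

section Metric

open ProbabilityTheory in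
lemma exists_gluing {X Y Z : Type*} [MeasurableSpace X] [StandardBorelSpace X] [Nonempty X]
    [MeasurableSpace Y] [MeasurableSpace Z] [StandardBorelSpace Z] [Nonempty Z]
    (γ₁ : Measure (X × Y)) (γ₂ : Measure (Y × Z)) [IsFiniteMeasure γ₁] [IsFiniteMeasure γ₂]
    (h : γ₁.snd = γ₂.fst) :
    ∃ π : Measure (Y × X × Z),
      π.map (fun q => (q.2.1, q.1)) = γ₁ ∧ π.map (fun q => (q.1, q.2.2)) = γ₂ := by
  have : IsFiniteMeasure (γ₁.map Prod.swap) := Measure.isFiniteMeasure_map γ₁ Prod.swap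
  let κ₁ := (γ₁.map Prod.swap).condKernel
  let κ₂ := γ₂.condKernel
  have e₁ : (γ₂.fst.compProd κ₁).map Prod.swap = γ₁ := by
    rw [← h, ← Measure.fst_map_swap, Measure.disintegrate,
      Measure.map_map measurable_swap measurable_swap, Prod.swap_swap_eq, Measure.map_id]
  have e₂ : γ₂.fst.compProd κ₂ = γ₂ := γ₂.disintegrate κ₂
  -- Given the common coordinate, the other two are taken independent.
  refine ⟨γ₂.fst.compProd (κ₁ ×ₖ κ₂), ?_, ?_⟩
  · have hmap := Measure.compProd_map (μ := γ₂.fst) (κ := κ₁ ×ₖ κ₂) measurable_fst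
    rw [← Kernel.fst_eq, Kernel.fst_prod] at hmap
    rw [← e₁, hmap, Measure.map_map (by fun_prop) (by fun_prop)]
    rfl
  · have hmap := Measure.compProd_map (μ := γ₂.fst) (κ := κ₁ ×ₖ κ₂) measurable_snd
    rw [← Kernel.snd_eq, Kernel.snd_prod, e₂] at hmap
    exact hmap.symm

variable {X : Type*} [NormedAddCommGroup X] [MeasurableSpace X] [BorelSpace X]
  [SecondCountableTopology X]

lemma W2_self (μ : P2 X) : W2 μ μ = 0 := by
  have hdiag : MeasurePreserving (fun x => (x, x)) μ.toMeasure (μ.toMeasure.map fun x => (x, x)) :=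
    ⟨by fun_prop, rfl⟩
  have hmem : μ.toMeasure.map (fun x => (x, x)) ∈ couplings μ μ :=
    ⟨(Measure.fst_map_prodMk measurable_id').trans Measure.map_id',
      (Measure.snd_map_prodMk measurable_id').trans Measure.map_id'⟩
  refine le_antisymm ((W2_le_eLpNorm hmem).trans_eq ?_) zero_le
  rw [← eLpNorm_comp_measurePreserving (by fun_prop) hdiag]
  simp [Function.comp_def]

lemma P2.memLp_id (μ : P2 X) : MemLp (fun x => x) 2 μ.toMeasure :=
  ⟨by fun_prop, μ.eLpNorm_id_lt_top⟩

lemma integrable_of_lipschitzWith {f : X → ℝ} {L : NNReal} (hf : LipschitzWith L f) (μ : P2 X) :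
    Integrable f μ.toMeasure := by
  have h : MemLp (fun x => f x - f 0) 2 μ.toMeasure :=
    (hf.sub (.const (f 0))).comp_memLp (by simp) μ.memLp_id
  simpa [sub_eq_add_neg] using h.integrable one_le_two

variable [CompleteSpace X]

lemma W2_comm_le (μ ν : P2 X) : W2 ν μ ≤ W2 μ ν := by
  obtain ⟨γ, hγ⟩ := exists_mem_optCouplings μ ν
  have hmem : γ.map Prod.swap ∈ couplings ν μ :=
    ⟨by rw [Measure.fst_map_swap, hγ.1.2], by rw [Measure.snd_map_swap, hγ.1.1]⟩
  have hswap : MeasurePreserving Prod.swap γ (γ.map Prod.swap) := ⟨measurable_swap, rfl⟩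
  rw [W2_eq_eLpNorm hγ, ← eLpNorm_neg]
  refine (W2_le_eLpNorm hmem).trans_eq ?_
  rw [← eLpNorm_comp_measurePreserving (by fun_prop) hswap]
  congr 1 with p
  simp

lemma W2_triangle (μ ν ρ : P2 X) : W2 μ ρ ≤ W2 μ ν + W2 ν ρ := by
  obtain ⟨γ₁, h₁⟩ := exists_mem_optCouplings μ ν
  obtain ⟨γ₂, h₂⟩ := exists_mem_optCouplings ν ρ
  have := isProbabilityMeasure_of_mem_couplings h₁.1
  have := isProbabilityMeasure_of_mem_couplings h₂.1
  obtain ⟨π, hπ₁, hπ₂⟩ := exists_gluing γ₁ γ₂ (h₁.1.2.trans h₂.1.1.symm)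
  have hp₁ : MeasurePreserving (fun q => (q.2.1, q.1)) π γ₁ := ⟨by fun_prop, hπ₁⟩
  have hp₂ : MeasurePreserving (fun q => (q.1, q.2.2)) π γ₂ := ⟨by fun_prop, hπ₂⟩
  have hp : MeasurePreserving Prod.snd π π.snd := ⟨measurable_snd, rfl⟩
  have hmem : π.snd ∈ couplings μ ρ :=
    ⟨((measurePreserving_fst_of_mem_couplings h₁.1).comp hp₁).map_eq ▸
      Measure.map_map measurable_fst measurable_snd,
    ((measurePreserving_snd_of_mem_couplings h₂.1).comp hp₂).map_eq ▸
      Measure.map_map measurable_snd measurable_snd⟩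
  calc W2 μ ρ ≤ eLpNorm (fun p => p.1 - p.2) 2 π.snd := W2_le_eLpNorm hmem
    _ = eLpNorm ((fun q : X × X × X => q.2.1 - q.1) + fun q => q.1 - q.2.2) 2 π := by
        rw [← eLpNorm_comp_measurePreserving (by fun_prop) hp]
        congr 1 with q
        simp
    _ ≤ eLpNorm (fun q : X × X × X => q.2.1 - q.1) 2 π +
          eLpNorm (fun q : X × X × X => q.1 - q.2.2) 2 π :=
        eLpNorm_add_le (by fun_prop) (by fun_prop) one_le_two
    _ = W2 μ ν + W2 ν ρ := by
        rw [W2_eq_eLpNorm h₁, W2_eq_eLpNorm h₂, ← eLpNorm_comp_measurePreserving (by fun_prop) hp₁,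
          ← eLpNorm_comp_measurePreserving (by fun_prop) hp₂]
        rfl

/-- The Wasserstein distance on `P2 X`, with which "continuous" and "Lipschitz" mean
`W2`-continuous and `W2`-Lipschitz. The weak topology is reached through `P2.toProb`. -/
noncomputable instance : PseudoEMetricSpace (P2 X) where
  edist := W2
  edist_self := W2_self
  edist_comm μ ν := le_antisymm (W2_comm_le ν μ) (W2_comm_le μ ν)
  edist_triangle := W2_triangle

lemma W2sq_eq_edist_sq (μ ν : P2 X) : W2sq μ ν = edist μ ν ^ 2 :=
  (W2_sq μ ν).symm

lemma edist_integral_le_mul_edist {f : X → ℝ} {L : NNReal} (hf : LipschitzWith L f) (μ ν : P2 X) :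
    edist (∫ x, f x ∂μ.toMeasure) (∫ x, f x ∂ν.toMeasure) ≤ L * edist μ ν := by
  obtain ⟨γ, hγ⟩ := exists_mem_optCouplings μ ν
  have := isProbabilityMeasure_of_mem_couplings hγ.1
  have hfst := measurePreserving_fst_of_mem_couplings hγ.1
  have hsnd := measurePreserving_snd_of_mem_couplings hγ.1
  have hf' (ρ : Measure X) : AEStronglyMeasurable f ρ := hf.continuous.aestronglyMeasurable
  have hμ : Integrable (fun p => f p.1) γ :=
    (hfst.integrable_comp (hf' _)).2 (integrable_of_lipschitzWith hf μ)
  have hν : Integrable (fun p => f p.2) γ :=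
    (hsnd.integrable_comp (hf' _)).2 (integrable_of_lipschitzWith hf ν)
  rw [← hfst.map_eq, ← hsnd.map_eq, integral_map hfst.aemeasurable (hf' _),
    integral_map hsnd.aemeasurable (hf' _), edist_eq_enorm_sub, ← integral_sub hμ hν]
  calc ‖∫ p, f p.1 - f p.2 ∂γ‖ₑ
      ≤ ∫⁻ p, ‖f p.1 - f p.2‖ₑ ∂γ := enorm_integral_le_lintegral_enorm _
    _ ≤ ∫⁻ p, L * ‖p.1 - p.2‖ₑ ∂γ := by
        refine lintegral_mono fun p => ?_
        simpa only [edist_eq_enorm_sub] using hf p.1 p.2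
    _ = L * eLpNorm (fun p => p.1 - p.2) 1 γ := by
        rw [lintegral_const_mul _ (by fun_prop), eLpNorm_one_eq_lintegral_enorm]
    _ ≤ L * eLpNorm (fun p => p.1 - p.2) 2 γ := by
        gcongr
        exact eLpNorm_le_eLpNorm_of_exponent_le one_le_two (by fun_prop)
    _ = L * W2 μ ν := by rw [W2_eq_eLpNorm hγ]

lemma P2.continuous_toProb : Continuous (P2.toProb : P2 X → ProbabilityMeasure X) := by
  refine continuous_iff_continuousAt.2 fun m => ?_
  rw [ContinuousAt, tendsto_iff_forall_lipschitz_integral_tendsto]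
  rintro f - ⟨L, hL⟩
  rw [tendsto_iff_edist_tendsto_0]
  have hlim : Tendsto (fun ν => L * edist ν m) (𝓝 m) (𝓝 0) :=
    ((ENNReal.continuous_const_mul ENNReal.coe_ne_top).comp
      (continuous_id.edist continuous_const)).tendsto' m 0 (by simp)
  exact tendsto_of_tendsto_of_tendsto_of_le_of_le tendsto_const_nhds hlim (fun _ => zero_le)
    fun ν => edist_integral_le_mul_edist hL ν m

lemma lintegral_enorm_le_add_edist (μ ν : P2 X) :
    ∫⁻ x, ‖x‖ₑ ∂ν.toMeasure ≤ ∫⁻ x, ‖x‖ₑ ∂μ.toMeasure + edist μ ν := by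
  have henorm (ρ : P2 X) : ∫⁻ x, ‖x‖ₑ ∂ρ.toMeasure = edist 0 (∫ x, ‖x‖ ∂ρ.toMeasure) := by
    rw [← ofReal_integral_norm_eq_lintegral_enorm (ρ.memLp_id.integrable one_le_two),
      edist_zero_left, ← enorm_eq_nnnorm,
      Real.enorm_of_nonneg (integral_nonneg fun _ => norm_nonneg _)]
  rw [henorm, henorm]
  refine (edist_triangle _ _ _).trans (add_le_add_right ?_ _)
  simpa using edist_integral_le_mul_edist lipschitzWith_one_norm μ ν

variable [ProperSpace X]

lemma isTightMeasureSet_image_closedEBall (m : P2 X) {R : ℝ≥0∞} (hR : R ≠ ⊤) :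
    IsTightMeasureSet (P2.toMeasure '' Metric.closedEBall m R) := by
  have hm : ∫⁻ x, ‖x‖ₑ ∂m.toMeasure ≠ ⊤ :=
    (m.memLp_id.integrable one_le_two).hasFiniteIntegral.ne
  refine (isTightMeasureSet_lintegral_enorm_le (ENNReal.add_ne_top.2 ⟨hm, hR⟩)).subset ?_
  rintro _ ⟨ν, hν, rfl⟩
  exact (lintegral_enorm_le_add_edist m ν).trans (add_le_add_right (Metric.mem_closedEBall'.1 hν) _)

variable {ι : Type*} {𝒰 : Ultrafilter ι} {m n : ι → P2 X} {m₀ : P2 X} {R : ℝ≥0∞}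

lemma exists_tendsto_of_mem_couplings (hm : Tendsto m 𝒰 (𝓝 m₀)) (hR : R ≠ ⊤)
    (hmn : ∀ᶠ i in 𝒰, edist (m i) (n i) ≤ R) {γ : ι → ProbabilityMeasure (X × X)}
    (hγ : ∀ᶠ i in 𝒰, (γ i : Measure (X × X)) ∈ couplings (m i) (n i)) :
    ∃ γ₀, Tendsto γ 𝒰 (𝓝 γ₀) := by
  have htight {r : ℝ≥0∞} (hr : r ≠ ⊤) := isTightMeasureSet_image_closedEBall m₀ hr
  refine exists_tendsto_of_isTightMeasureSet (isTightMeasureSet_fst_snd_mem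
    (htight ENNReal.one_ne_top) (htight (ENNReal.add_ne_top.2 ⟨hR, ENNReal.one_ne_top⟩))) 𝒰 ?_
  filter_upwards [hmn, hγ, hm.eventually (Metric.closedEBall_mem_nhds m₀ one_pos)]
    with i hi hγi hmi
  refine ⟨⟨m i, hmi, hγi.1.symm⟩, ⟨n i, ?_, hγi.2.symm⟩⟩
  exact (edist_triangle_left (n i) m₀ (m i)).trans (add_le_add hi hmi)

lemma W2sq_le_of_tendsto {n₀ : P2 X} (hm : Tendsto m 𝒰 (𝓝 m₀)) (hR : R ≠ ⊤)
    (hmn : ∀ᶠ i in 𝒰, edist (m i) (n i) ≤ R)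
    (hn : Tendsto (fun i => (n i).toProb) 𝒰 (𝓝 n₀.toProb)) {w : ℝ≥0∞}
    (hw : Tendsto (fun i => W2sq (m i) (n i)) 𝒰 (𝓝 w)) : W2sq m₀ n₀ ≤ w := by
  choose γ hγ using fun i => exists_mem_optCouplings (m i) (n i)
  let P i : ProbabilityMeasure (X × X) := ⟨γ i, isProbabilityMeasure_of_mem_couplings (hγ i).1⟩
  have hP : ∀ᶠ i in 𝒰, (P i : Measure (X × X)) ∈ couplings (m i) (n i) :=
    .of_forall fun i => (hγ i).1
  obtain ⟨γ₀, hγ₀⟩ := exists_tendsto_of_mem_couplings hm hR hmn hP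
  have hmem := mem_couplings_of_tendsto ((P2.continuous_toProb.tendsto m₀).comp hm) hn hγ₀ hP
  exact (W2sq_le_cost hmem).trans (lowerSemicontinuous_cost.isClosed_epigraph.mem_of_tendsto
    (hγ₀.prodMk_nhds hw) (.of_forall fun i => (hγ i).2.le))

end Metric

section Barycenters

variable {d N : ℕ}

lemma measurePreserving_agent (μ : P2 (Ensemble d N)) (i : Fin N) :
    MeasurePreserving (fun x => x i) μ.toMeasure (agent μ i).toMeasure :=
  ⟨by fun_prop, rfl⟩

lemma edist_agent_le (μ ν : P2 (Ensemble d N)) (i : Fin N) :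
    edist (agent μ i) (agent ν i) ≤ edist μ ν := by
  obtain ⟨γ, hγ⟩ := exists_mem_optCouplings μ ν
  let proj (p : Ensemble d N × Ensemble d N) : Space d × Space d := (p.1 i, p.2 i)
  have hproj : MeasurePreserving proj γ (γ.map proj) := ⟨by fun_prop, rfl⟩
  have hmem : γ.map proj ∈ couplings (agent μ i) (agent ν i) :=
    ⟨((measurePreserving_agent μ i).comp (measurePreserving_fst_of_mem_couplings hγ.1)).map_eq ▸
      Measure.map_map measurable_fst hproj.measurable,
    ((measurePreserving_agent ν i).comp (measurePreserving_snd_of_mem_couplings hγ.1)).map_eq ▸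
      Measure.map_map measurable_snd hproj.measurable⟩
  calc edist (agent μ i) (agent ν i) ≤ eLpNorm (fun p => p.1 - p.2) 2 (γ.map proj) :=
        W2_le_eLpNorm hmem
    _ = eLpNorm (fun p => p.1 i - p.2 i) 2 γ :=
        (eLpNorm_comp_measurePreserving (by fun_prop) hproj).symm
    _ ≤ eLpNorm (fun p => p.1 - p.2) 2 γ :=
        eLpNorm_mono fun p => PiLp.norm_apply_le (p.1 - p.2) i
    _ = edist μ ν := (W2_eq_eLpNorm hγ).symm

lemma continuous_agent (i : Fin N) : Continuous fun μ : P2 (Ensemble d N) => agent μ i :=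
  (LipschitzWith.of_edist_le fun μ ν => edist_agent_le μ ν i).continuous

variable {lam : P2 (Space d) → ℝ}

lemma continuous_barFunctional_left (hlam : Continuous lam) (ν : P2 (Space d)) :
    Continuous fun μ : P2 (Ensemble d N) => barFunctional lam μ ν := by
  refine continuous_finsetSum _ fun k _ => continuous_iff_continuousAt.2 fun μ => ?_
  have hk := continuous_agent (d := d) k
  have hW : Continuous fun μ : P2 (Ensemble d N) => W2sq (agent μ k) ν := by
    simp_rw [W2sq_eq_edist_sq]
    exact (ENNReal.continuous_pow 2).comp (hk.edist continuous_const)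
  exact ENNReal.Tendsto.mul (ENNReal.continuous_ofReal.comp (hlam.comp hk)).continuousAt
    (Or.inr (W2sq_lt_top _ _).ne) hW.continuousAt (Or.inr ENNReal.ofReal_ne_top)

lemma barFunctional_lt_top (μ : P2 (Ensemble d N)) (ν : P2 (Space d)) :
    barFunctional lam μ ν < ⊤ :=
  ENNReal.sum_lt_top.2 fun _ _ => ENNReal.mul_lt_top ENNReal.ofReal_lt_top (W2sq_lt_top _ _)

lemma exists_eventually_edist_le_of_mem_Bar (hlam : Continuous lam) (hpos : ∀ m, 0 < lam m)
    (μ : P2 (Ensemble d N)) (k : Fin N) :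
    ∃ R ≠ ⊤, ∀ᶠ m in 𝓝 μ, ∀ ν ∈ Bar lam m, edist (agent m k) ν ≤ R := by
  let ν' := agent μ k
  let bound (m : P2 (Ensemble d N)) := barFunctional lam m ν' / ENNReal.ofReal (lam (agent m k))
  have hle (m) (ν) (hν : ν ∈ Bar lam m) : W2sq (agent m k) ν ≤ bound m := by
    rw [ENNReal.le_div_iff_mul_le (by simp [hpos]) (by simp), mul_comm]
    exact (Finset.single_le_sum
      (f := fun k => ENNReal.ofReal (lam (agent m k)) * W2sq (agent m k) ν)
      (fun _ _ => zero_le) (Finset.mem_univ k)).trans (hν ν')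
  have hcont : ContinuousAt bound μ :=
    ENNReal.Tendsto.div (continuous_barFunctional_left hlam ν').continuousAt
      (Or.inr (by simp [hpos]))
      (ENNReal.continuous_ofReal.comp (hlam.comp (continuous_agent k))).continuousAt
      (Or.inl ENNReal.ofReal_ne_top)
  have hfin : bound μ < ⊤ := ENNReal.div_lt_top (barFunctional_lt_top μ ν').ne (by simp [hpos])
  obtain ⟨B, hμB, hB⟩ := exists_between hfin
  refine ⟨B ^ (1 / 2 : ℝ), ENNReal.rpow_ne_top_of_nonneg (by positivity) hB.ne, ?_⟩
  filter_upwards [hcont.eventually_lt_const hμB] with m hm ν hν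
  exact ENNReal.rpow_le_rpow ((hle m ν hν).trans hm.le) (by positivity)

/-- The optimal plans `Γₒ(μʲ, Bar)` from the `j`-th agent of `μ` to a barycenter, with the weak
topology. -/
def barPlans (lam : P2 (Space d) → ℝ) (μ : P2 (Ensemble d N)) (j : Fin N) :
    Set (ProbabilityMeasure (Space d × Space d)) :=
  {γ | ∃ ν ∈ Bar lam μ, (γ : Measure (Space d × Space d)) ∈ optCouplings (agent μ j) ν}

lemma eq_of_sum_mul_le {ι : Type*} [Fintype ι] {c a b : ι → ℝ≥0∞} (hc : ∀ i, c i ≠ 0)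
    (hc' : ∀ i, c i ≠ ⊤) (hab : ∀ i, a i ≤ b i) (h : ∑ i, c i * b i ≤ ∑ i, c i * a i)
    (ht : ∑ i, c i * a i ≠ ⊤) (i : ι) : a i = b i := by
  classical
  have hsplit (f : ι → ℝ≥0∞) :
      ∑ k, c k * f k = c i * f i + ∑ k ∈ Finset.univ.erase i, c k * f k :=
    (Finset.add_sum_erase _ _ (Finset.mem_univ i)).symm
  rw [hsplit] at ht
  have hi : c i * b i ≤ c i * a i := by
    refine ENNReal.le_of_add_le_add_right (ENNReal.add_ne_top.1 ht).2 ?_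
    rw [← hsplit a]
    refine le_trans ?_ ((hsplit b).symm.trans_le h)
    gcongr
    exact hab _
  exact le_antisymm (hab i) ((ENNReal.mul_le_mul_iff_right (hc i) (hc' i)).1 hi)

/-- Upper bounds `w` on the transport costs to `ν` that still realise the minimal value must be
equalities, so that `ν` is a barycenter and `γ` is optimal. -/
lemma mem_barPlans_of_le (hpos : ∀ m, 0 < lam m) {μ : P2 (Ensemble d N)} {ν : P2 (Space d)}
    {w : Fin N → ℝ≥0∞} (hw : ∀ k, W2sq (agent μ k) ν ≤ w k)
    (hmin : ∀ ν', ∑ k, ENNReal.ofReal (lam (agent μ k)) * w k ≤ barFunctional lam μ ν')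
    {j : Fin N} {γ : ProbabilityMeasure (Space d × Space d)}
    (hγ : (γ : Measure (Space d × Space d)) ∈ couplings (agent μ j) ν)
    (hcost : cost (γ : Measure (Space d × Space d)) ≤ w j) : γ ∈ barPlans lam μ j := by
  have hbar : ν ∈ Bar lam μ := fun ν' =>
    (Finset.sum_le_sum fun k _ => mul_le_mul_right (hw k) _).trans (hmin ν')
  have heq : W2sq (agent μ j) ν = w j :=
    eq_of_sum_mul_le (by simp [hpos]) (by simp) hw (hmin ν) (barFunctional_lt_top μ ν).ne j
  exact ⟨ν, hbar, hγ, le_antisymm (hcost.trans_eq heq.symm) (W2sq_le_cost hγ)⟩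

lemma exists_tendsto_mem_barPlans (hlam : Continuous lam) (hpos : ∀ m, 0 < lam m) {ι : Type*}
    {𝒰 : Ultrafilter ι} {m : ι → P2 (Ensemble d N)} {μ : P2 (Ensemble d N)}
    (hm : Tendsto m 𝒰 (𝓝 μ)) {j : Fin N} {γ : ι → ProbabilityMeasure (Space d × Space d)}
    (hγ : ∀ᶠ i in 𝒰, γ i ∈ barPlans lam (m i) j) :
    ∃ γ₀ ∈ barPlans lam μ j, Tendsto γ 𝒰 (𝓝 γ₀) := by
  obtain ⟨n, hn⟩ := hγ.choice
  have hA (k : Fin N) := ((continuous_agent (d := d) k).tendsto μ).comp hm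
  have hbdd (k : Fin N) : ∃ R ≠ ⊤, ∀ᶠ i in 𝒰, edist (agent (m i) k) (n i) ≤ R := by
    obtain ⟨R, hR, hball⟩ := exists_eventually_edist_le_of_mem_Bar hlam hpos μ k
    exact ⟨R, hR, (hm.eventually hball).mp (hn.mono fun i hi h => h _ hi.1)⟩
  choose R hR hedist using hbdd
  obtain ⟨γ₀, hγ₀⟩ :=
    exists_tendsto_of_mem_couplings (hA j) (hR j) (hedist j) (hn.mono fun i hi => hi.2.1)
  -- The barycenters `n i` converge only weakly, so their minimality passes to the limits `w k` of
  -- the transport costs, not directly to the costs of the limit.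
  let w (k : Fin N) : ℝ≥0∞ := (𝒰.map fun i => W2sq (agent (m i) k) (n i)).lim
  have hw (k : Fin N) : Tendsto (fun i => W2sq (agent (m i) k) (n i)) 𝒰 (𝓝 (w k)) :=
    Ultrafilter.le_nhds_lim _
  have hcost : cost (γ₀ : Measure (Space d × Space d)) ≤ w j :=
    lowerSemicontinuous_cost.isClosed_epigraph.mem_of_tendsto (hγ₀.prodMk_nhds (hw j))
      (hn.mono fun i hi => hi.2.2.le)
  have hwj : w j ≤ R j ^ 2 := le_of_tendsto (hw j) <| (hedist j).mono fun i hi => by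
    rw [W2sq_eq_edist_sq]
    gcongr
  obtain ⟨ν, hν, hnν⟩ := exists_mem_couplings_of_tendsto
    ((P2.continuous_toProb.tendsto _).comp (hA j)) hγ₀ (hn.mono fun i hi => hi.2.1)
    (hcost.trans_lt (hwj.trans_lt (ENNReal.pow_lt_top (hR j).lt_top)))
  refine ⟨γ₀, mem_barPlans_of_le hpos
    (fun k => W2sq_le_of_tendsto (hA k) (hR k) (hedist k) hnν (hw k)) (fun ν' => ?_) hν hcost, hγ₀⟩
  refine le_of_tendsto_of_tendsto (tendsto_finsetSum _ fun k _ => ?_)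
    (((continuous_barFunctional_left hlam ν').tendsto μ).comp hm) (hn.mono fun i hi => hi.1 ν')
  exact ENNReal.Tendsto.mul
    ((ENNReal.continuous_ofReal.tendsto _).comp ((hlam.tendsto _).comp (hA k)))
    (Or.inl (by simp [hpos])) (hw k) (Or.inr ENNReal.ofReal_ne_top)

lemma W2sq_le_of_toMeasure_eq {X : Type*} [NormedAddCommGroup X] [MeasurableSpace X] [BorelSpace X]
    [SecondCountableTopology X] [CompleteSpace X] (μ : P2 X) {ν ν₀ ν₁ : P2 X} {a b : NNReal}
    (hab : a + b = 1) (hν : ν.toMeasure = a • ν₀.toMeasure + b • ν₁.toMeasure) :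
    W2sq μ ν ≤ a * W2sq μ ν₀ + b * W2sq μ ν₁ := by
  obtain ⟨γ₀, h₀, hcost₀⟩ := exists_mem_optCouplings μ ν₀
  obtain ⟨γ₁, h₁, hcost₁⟩ := exists_mem_optCouplings μ ν₁
  have hmem : a • γ₀ + b • γ₁ ∈ couplings μ ν := by
    constructor
    · rw [fst_smul_add_smul, h₀.1, h₁.1, Convex.combo_self hab]
    · rw [snd_smul_add_smul, h₀.2, h₁.2, hν]
  rw [← hcost₀, ← hcost₁, ← cost_smul_add_smul]
  exact W2sq_le_cost hmem

lemma isPreconnected_barPlans (hpos : ∀ m, 0 < lam m) (μ : P2 (Ensemble d N)) (j : Fin N) :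
    IsPreconnected (barPlans lam μ j) := by
  refine isPreconnected_of_forall_mixture_mem ?_
  rintro γ₀ ⟨ν₀, hν₀, h₀, hcost₀⟩ γ₁ ⟨ν₁, hν₁, h₁, hcost₁⟩ γ a b hab hγ
  have hcost : cost (γ : Measure (Space d × Space d)) =
      a * W2sq (agent μ j) ν₀ + b * W2sq (agent μ j) ν₁ := by
    rw [hγ, cost_smul_add_smul, hcost₀, hcost₁]
  have hfst : (γ : Measure (Space d × Space d)).fst = (agent μ j).toMeasure := by
    rw [hγ, fst_smul_add_smul, h₀.1, h₁.1, Convex.combo_self hab]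
  obtain ⟨ν, hν⟩ := exists_mem_couplings_of_cost_lt_top hfst (hcost.trans_lt
    (ENNReal.add_lt_top.2 ⟨ENNReal.mul_lt_top ENNReal.coe_lt_top (W2sq_lt_top _ _),
      ENNReal.mul_lt_top ENNReal.coe_lt_top (W2sq_lt_top _ _)⟩))
  have hmix : ν.toMeasure = a • ν₀.toMeasure + b • ν₁.toMeasure := by
    rw [← hν.2, ← h₀.2, ← h₁.2, hγ, snd_smul_add_smul]
  refine mem_barPlans_of_le hpos (fun k => W2sq_le_of_toMeasure_eq (agent μ k) hab hmix)
    (fun ν' => ?_) hν hcost.le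
  calc ∑ k, ENNReal.ofReal (lam (agent μ k)) *
        (a * W2sq (agent μ k) ν₀ + b * W2sq (agent μ k) ν₁)
      = a * barFunctional lam μ ν₀ + b * barFunctional lam μ ν₁ := by
        simp_rw [barFunctional, Finset.mul_sum, ← Finset.sum_add_distrib]
        exact Finset.sum_congr rfl fun k _ => by ring
    _ ≤ a * barFunctional lam μ ν' + b * barFunctional lam μ ν' := by
        gcongr
        exacts [hν₀ ν', hν₁ ν']
    _ = barFunctional lam μ ν' := by
        rw [← add_mul]
        norm_cast
        simp [hab]

end Barycenters

section SetValued

variable {Y Z : Type*} [TopologicalSpace Y] [TopologicalSpace Z] {F : Y → Set Z} {y : Y}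

lemma upperHemicontinuousAt_of_ultrafilter
    (h : ∀ 𝒰 : Ultrafilter (Y × Z), Tendsto (fun p : Y × Z => p.1) 𝒰 (𝓝 y) →
      (∀ᶠ p : Y × Z in 𝒰, p.2 ∈ F p.1) → ∃ z ∈ F y, Tendsto (fun p : Y × Z => p.2) 𝒰 (𝓝 z)) :
    UpperHemicontinuousAt F y := by
  refine upperHemicontinuousAt_iff_forall_isOpen.2 fun U hU hFU => ?_
  by_contra hcon
  let bad : Set (Y × Z) := {p | p.2 ∈ F p.1 ∧ p.2 ∉ U}
  have hbad : (comap Prod.fst (𝓝 y) ⊓ 𝓟 bad).NeBot := by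
    rw [← frequently_mem_iff_neBot, frequently_comap]
    refine (not_eventually.1 hcon).mono fun y' hy' => ?_
    obtain ⟨z, hz, hzU⟩ := not_subset.1 hy'
    exact ⟨(y', z), rfl, hz, hzU⟩
  let 𝒰 := Ultrafilter.of (comap Prod.fst (𝓝 y) ⊓ 𝓟 bad)
  have h𝒰 : (𝒰 : Filter (Y × Z)) ≤ comap Prod.fst (𝓝 y) ⊓ 𝓟 bad := Ultrafilter.of_le _
  have hmem : ∀ᶠ p in 𝒰, p ∈ bad := h𝒰.trans inf_le_right (mem_principal_self bad)
  obtain ⟨z, hz, hlim⟩ := h 𝒰 (tendsto_iff_comap.2 (h𝒰.trans inf_le_left))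
    (hmem.mono fun _ hp => hp.1)
  obtain ⟨p, hp, hpU⟩ := (hmem.and (hlim.eventually (hU.mem_nhds (hFU hz)))).exists
  exact hp.2 hpU

lemma isCompact_of_ultrafilter
    (h : ∀ 𝒰 : Ultrafilter (Y × Z), Tendsto (fun p : Y × Z => p.1) 𝒰 (𝓝 y) →
      (∀ᶠ p : Y × Z in 𝒰, p.2 ∈ F p.1) → ∃ z ∈ F y, Tendsto (fun p : Y × Z => p.2) 𝒰 (𝓝 z)) :
    IsCompact (F y) :=
  isCompact_iff_ultrafilter_le_nhds'.2 fun 𝒰 h𝒰 =>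
    h (𝒰.map (Prod.mk y)) tendsto_const_nhds h𝒰

end SetValued

section Pairings

variable {d N : ℕ} {φ : Ensemble d N → ℝ}

/-- The velocity of the ensemble whose `i`-th agent travels from `(z i).1` to `(z i).2` in unit
time. -/
def velocity (z : Fin N → Space d × Space d) : Ensemble d N :=
  WithLp.toLp 2 fun i => (z i).2 - (z i).1

@[fun_prop]
lemma continuous_velocity : Continuous (velocity (d := d) (N := N)) := by
  unfold velocity
  fun_prop

/-- The pairing `⟨∇φ, ⨂ᵢ (π₀, π₁ - π₀)_# γⁱ⟩`, as a function of the transport plans `γⁱ`. -/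
noncomputable def planPairing (φ : Ensemble d N → ℝ)
    (γ : Fin N → ProbabilityMeasure (Space d × Space d)) : ℝ :=
  gradPairing φ (tensor fun i => (γ i).toMeasure.map fun p => (p.1, p.2 - p.1))

lemma planPairing_eq_integral (hφ : ContDiff ℝ 1 φ)
    (γ : Fin N → ProbabilityMeasure (Space d × Space d)) :
    planPairing φ γ = ∫ z, fderiv ℝ φ (WithLp.toLp 2 fun i => (z i).1)
      (velocity z) ∂(ProbabilityMeasure.pi γ).toMeasure := by
  have hcont : Continuous fun p : Ensemble d N × Ensemble d N => fderiv ℝ φ p.1 p.2 :=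
    ((hφ.continuous_fderiv one_ne_zero).comp continuous_fst).clm_apply continuous_snd
  have (i : Fin N) : IsProbabilityMeasure
      ((γ i).toMeasure.map fun p => (p.1, p.2 - p.1)) :=
    Measure.isProbabilityMeasure_map (by fun_prop)
  rw [planPairing, gradPairing, tensor, ← Measure.pi_map_pi (fun i => by fun_prop),
    Measure.map_map (by fun_prop) (by fun_prop),
    integral_map (by fun_prop) hcont.aestronglyMeasurable]
  rfl

lemma enorm_velocity_sq (z : Fin N → Space d × Space d) :
    ‖velocity z‖ₑ ^ 2 = ∑ i, ‖(z i).1 - (z i).2‖ₑ ^ 2 := by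
  rw [← ofReal_norm, ← ENNReal.ofReal_pow (norm_nonneg _), PiLp.norm_sq_eq_of_L2,
    ENNReal.ofReal_sum_of_nonneg (fun _ _ => by positivity)]
  refine Finset.sum_congr rfl fun i _ => ?_
  rw [ENNReal.ofReal_pow (norm_nonneg _), ofReal_norm, enorm_sub_rev]
  rfl

lemma lintegral_enorm_velocity_sq (γ : Fin N → ProbabilityMeasure (Space d × Space d)) :
    ∫⁻ z, ‖velocity z‖ₑ ^ 2 ∂(ProbabilityMeasure.pi γ).toMeasure =
      ∑ i, cost (γ i).toMeasure := by
  simp_rw [enorm_velocity_sq]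
  rw [lintegral_finsetSum _ fun i _ => by fun_prop]
  refine Finset.sum_congr rfl fun i _ => ?_
  exact (measurePreserving_eval (fun i => (γ i).toMeasure) i).lintegral_comp
    (f := fun p : Space d × Space d => ‖p.1 - p.2‖ₑ ^ 2) (by fun_prop)

lemma continuousOn_planPairing (hφ : ContDiff ℝ 1 φ) (hφc : HasCompactSupport φ) {B : ℝ≥0∞}
    (hB : B ≠ ⊤) :
    ContinuousOn (planPairing φ) {γ | ∑ i, cost (γ i).toMeasure ≤ B} := by
  let g (z : Fin N → Space d × Space d) : ℝ :=
    fderiv ℝ φ (WithLp.toLp 2 fun i => (z i).1) (velocity z)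
  have hg : Continuous g :=
    ((hφ.continuous_fderiv one_ne_zero).comp (by fun_prop)).clm_apply (by fun_prop)
  obtain ⟨C, hC⟩ := (hφ.continuous_fderiv one_ne_zero).bounded_above_of_compact_support
    (hφc.fderiv ℝ)
  have hgle (z) : ‖g z‖ₑ ≤ ENNReal.ofReal C * ‖velocity z‖ₑ := by
    refine (ContinuousLinearMap.le_opENorm _ _).trans ?_
    gcongr
    rw [← ofReal_norm]
    exact ENNReal.ofReal_le_ofReal (hC _)
  refine ((continuousOn_integral_of_lintegral_sq_le hg
    (B := ENNReal.ofReal C ^ 2 * B) (by finiteness)).comp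
      ProbabilityMeasure.continuous_pi.continuousOn fun γ hγ => ?_).congr
        fun γ _ => planPairing_eq_integral hφ γ
  calc ∫⁻ z, ‖g z‖ₑ ^ 2 ∂(ProbabilityMeasure.pi γ).toMeasure
      ≤ ∫⁻ z, ENNReal.ofReal C ^ 2 * ‖velocity z‖ₑ ^ 2
          ∂(ProbabilityMeasure.pi γ).toMeasure := by
        refine lintegral_mono fun z => ?_
        rw [← mul_pow]
        gcongr
        exact hgle z
    _ = ENNReal.ofReal C ^ 2 * ∑ i, cost (γ i).toMeasure := by
        rw [lintegral_const_mul _ (by fun_prop), lintegral_enorm_velocity_sq]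
    _ ≤ ENNReal.ofReal C ^ 2 * B := by
        gcongr
        exact hγ

/-- The set `{⟨∇φ, W⟩ : W ∈ 𝒱[μ]}` of admissible derivatives of `∫ φ dμₜ` at `μₜ = μ`. -/
def pairings (lam : P2 (Space d) → ℝ) (φ : Ensemble d N → ℝ) (μ : P2 (Ensemble d N)) : Set ℝ :=
  gradPairing φ '' field lam μ

variable {lam : P2 (Space d) → ℝ}

lemma pairings_eq_image_barPlans (μ : P2 (Ensemble d N)) :
    pairings lam φ μ = planPairing φ '' univ.pi (barPlans lam μ) := by
  ext x
  constructor
  · rintro ⟨_, ⟨γ, hγ, rfl⟩, rfl⟩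
    have hprob (i : Fin N) : IsProbabilityMeasure (γ i) :=
      let ⟨_, _, hopt⟩ := hγ i
      isProbabilityMeasure_of_mem_couplings hopt.1
    exact ⟨fun i => ⟨γ i, hprob i⟩, fun i _ => hγ i, rfl⟩
  · rintro ⟨γ, hγ, rfl⟩
    exact ⟨_, ⟨fun i => γ i, fun i => hγ i (mem_univ i), rfl⟩, rfl⟩

lemma exists_eventually_sum_cost_le (hlam : Continuous lam) (hpos : ∀ m, 0 < lam m)
    (μ : P2 (Ensemble d N)) :
    ∃ B ≠ ⊤, ∀ᶠ m in 𝓝 μ, ∀ γ ∈ univ.pi (barPlans lam m),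
      ∑ i, cost (γ i).toMeasure ≤ B := by
  choose R hR hev using exists_eventually_edist_le_of_mem_Bar hlam hpos μ
  refine ⟨∑ i, R i ^ 2, ENNReal.sum_ne_top.2 fun i _ => ENNReal.pow_ne_top (hR i), ?_⟩
  filter_upwards [eventually_all.2 hev] with m hm γ hγ
  refine Finset.sum_le_sum fun i _ => ?_
  obtain ⟨ν, hν, -, hcost⟩ := hγ i (mem_univ i)
  rw [hcost, W2sq_eq_edist_sq]
  gcongr
  exact hm i ν hν

lemma exists_tendsto_mem_pairings (hlam : Continuous lam) (hpos : ∀ m, 0 < lam m)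
    (hφ : ContDiff ℝ 1 φ) (hφc : HasCompactSupport φ) {ι : Type*} {𝒰 : Ultrafilter ι}
    {m : ι → P2 (Ensemble d N)} {μ : P2 (Ensemble d N)} (hm : Tendsto m 𝒰 (𝓝 μ)) {x : ι → ℝ}
    (hx : ∀ᶠ i in 𝒰, x i ∈ pairings lam φ (m i)) :
    ∃ x₀ ∈ pairings lam φ μ, Tendsto x 𝒰 (𝓝 x₀) := by
  simp only [pairings_eq_image_barPlans] at hx ⊢
  obtain ⟨γ, hγ⟩ := hx.choice
  choose γ₀ hγ₀ hlim using fun i : Fin N => exists_tendsto_mem_barPlans hlam hpos hm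
    (hγ.mono fun _ hγ' => hγ'.1 i (mem_univ i))
  obtain ⟨B, hB, hcost⟩ := exists_eventually_sum_cost_le hlam hpos μ
  refine ⟨_, mem_image_of_mem _ fun i _ => hγ₀ i, ?_⟩
  have hcont := continuousOn_planPairing hφ hφc hB γ₀ (hcost.self_of_nhds γ₀ fun i _ => hγ₀ i)
  refine (hcont.tendsto.comp (tendsto_nhdsWithin_iff.2 ⟨tendsto_pi_nhds.2 hlim, ?_⟩)).congr' ?_
  · filter_upwards [hγ, hm.eventually hcost] with i hi hiB using hiB _ hi.1
  · exact hγ.mono fun _ hi => hi.2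

lemma upperHemicontinuousAt_pairings (hlam : Continuous lam) (hpos : ∀ m, 0 < lam m)
    (hφ : ContDiff ℝ 1 φ) (hφc : HasCompactSupport φ) (μ : P2 (Ensemble d N)) :
    UpperHemicontinuousAt (pairings lam φ) μ :=
  upperHemicontinuousAt_of_ultrafilter fun _ hm hx =>
    exists_tendsto_mem_pairings hlam hpos hφ hφc hm hx

lemma isCompact_pairings (hlam : Continuous lam) (hpos : ∀ m, 0 < lam m)
    (hφ : ContDiff ℝ 1 φ) (hφc : HasCompactSupport φ) (μ : P2 (Ensemble d N)) :
    IsCompact (pairings lam φ μ) :=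
  isCompact_of_ultrafilter fun _ hm hx => exists_tendsto_mem_pairings hlam hpos hφ hφc hm hx

lemma convex_pairings (hlam : Continuous lam) (hpos : ∀ m, 0 < lam m)
    (hφ : ContDiff ℝ 1 φ) (hφc : HasCompactSupport φ) (μ : P2 (Ensemble d N)) :
    Convex ℝ (pairings lam φ μ) := by
  obtain ⟨B, hB, hcost⟩ := exists_eventually_sum_cost_le hlam hpos μ
  rw [pairings_eq_image_barPlans]
  -- Products of plans do not form a convex set, but in `ℝ` connectedness is enough.
  refine (IsPreconnected.image ?_ _ ?_).convex
  · exact isPreconnected_univ_pi fun j => isPreconnected_barPlans hpos μ j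
  · exact (continuousOn_planPairing hφ hφc hB).mono hcost.self_of_nhds

end Pairings

lemma lipschitzOnWith_of_tendsto {X Y ι : Type*} [PseudoEMetricSpace X] [PseudoEMetricSpace Y]
    {l : Filter ι} [l.NeBot] {K : NNReal} {s : Set X} {f : ι → X → Y} {f₀ : X → Y}
    (hf : ∀ᶠ i in l, LipschitzOnWith K (f i) s)
    (hlim : ∀ x ∈ s, Tendsto (fun i => f i x) l (𝓝 (f₀ x))) : LipschitzOnWith K f₀ s :=
  fun x hx y hy => le_of_tendsto ((hlim x hx).edist (hlim y hy)) (hf.mono fun _ hi => hi hx hy)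

section ScalarInclusions

variable {T : ℝ}

/-- `f` solves the scalar differential inclusion `f' ∈ S` on `[0, T]`. -/
def SolvesInclusion (T : ℝ) (S : ℝ → Set ℝ) (f : ℝ → ℝ) : Prop :=
  AbsolutelyContinuousOnInterval f 0 T ∧ ∀ᵐ t ∂(volume.restrict (Icc 0 T)),
    ∃ y ∈ S t, HasDerivWithinAt f y (Icc 0 T) t

section Solutions

variable {S : ℝ → Set ℝ} {f : ℝ → ℝ} {a b : ℝ} {J : Set ℝ}

lemma SolvesInclusion.ae_deriv_mem (h : SolvesInclusion T S f) :
    ∀ᵐ t ∂(volume.restrict (Icc 0 T)), deriv f t ∈ S t := by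
  have hae := h.2
  rw [← Measure.restrict_congr_set Ioo_ae_eq_Icc] at hae ⊢
  filter_upwards [hae, ae_restrict_mem measurableSet_Ioo] with t ⟨y, hy, hd⟩ ht
  rwa [(hd.hasDerivAt (Icc_mem_nhds ht.1 ht.2)).deriv]

lemma slope_mem_of_ae_deriv_mem (hab : a < b) (hf : AbsolutelyContinuousOnInterval f a b)
    (hJ : Convex ℝ J) (hJc : IsClosed J) (hd : ∀ᵐ t ∂(volume.restrict (Icc a b)), deriv f t ∈ J) :
    slope f a b ∈ J := by
  rw [slope_def_field, ← hf.integral_deriv_eq_sub, ← interval_average_eq_div, uIoc_of_le hab.le]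
  refine hJ.set_average_mem hJc (by simp [hab]) (by simp) ?_
    (hf.intervalIntegrable_deriv.1)
  exact ae_restrict_of_ae_restrict_of_subset Ioc_subset_Icc_self hd

lemma SolvesInclusion.slope_mem (h : SolvesInclusion T S f) (ha : a ∈ Icc 0 T) (hb : b ∈ Icc 0 T)
    (hab : a < b) (hJ : Convex ℝ J) (hJc : IsClosed J) (hSJ : ∀ t ∈ Icc a b, S t ⊆ J) :
    slope f a b ∈ J := by
  have hsub : Icc a b ⊆ Icc 0 T := Icc_subset_Icc ha.1 hb.2
  refine slope_mem_of_ae_deriv_mem hab (h.1.mono ?_) hJ hJc ?_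
  · rwa [uIcc_of_le hab.le, uIcc_of_le (ha.1.trans ha.2)]
  · filter_upwards [ae_restrict_of_ae_restrict_of_subset hsub h.ae_deriv_mem,
      ae_restrict_mem measurableSet_Icc] with t ht htab using hSJ t htab ht

lemma SolvesInclusion.lipschitzOnWith (h : SolvesInclusion T S f) {C : NNReal}
    (hC : ∀ t ∈ Icc 0 T, S t ⊆ Metric.closedBall 0 C) : LipschitzOnWith C f (Icc 0 T) := by
  have key {a b : ℝ} (ha : a ∈ Icc 0 T) (hb : b ∈ Icc 0 T) (hab : a < b) :
      dist (f a) (f b) ≤ C * dist a b := by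
    have hslope := h.slope_mem ha hb hab (convex_closedBall 0 (C : ℝ)) Metric.isClosed_closedBall
      fun t ht => hC t (Icc_subset_Icc ha.1 hb.2 ht)
    have hpos : 0 < ‖b - a‖ := norm_pos_iff.2 (sub_ne_zero.2 hab.ne')
    rwa [mem_closedBall_zero_iff, slope_def_field, norm_div, div_le_iff₀ hpos, ← dist_eq_norm,
      ← dist_eq_norm, dist_comm, dist_comm b] at hslope
  refine LipschitzOnWith.of_dist_le_mul fun x hx y hy => ?_
  rcases lt_trichotomy x y with hxy | rfl | hxy
  · exact key hx hy hxy
  · simp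
  · simpa only [dist_comm] using key hy hx hxy

end Solutions

variable {Y ι : Type*} [TopologicalSpace Y] {F : Y → Set ℝ} {l : Filter ι} {u : ι → ℝ → Y}
  {μ : ℝ → Y} {f : ι → ℝ → ℝ} {f₀ : ℝ → ℝ}

lemma eventually_subset_cthickening (hF : ∀ y, UpperHemicontinuousAt F y) {t : ℝ}
    (hu : Tendsto (fun p : ι × ℝ => u p.1 p.2) (l ×ˢ 𝓝[Icc 0 T] t) (𝓝 (μ t)))
    {δ : ℝ} (hδ : 0 < δ) :
    ∀ᶠ p in l ×ˢ 𝓝[Icc 0 T] t, F (u p.1 p.2) ⊆ Metric.cthickening δ (F (μ t)) := by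
  have hopen := upperHemicontinuousAt_iff_forall_isOpen.1 (hF (μ t)) _ Metric.isOpen_thickening
    (Metric.self_subset_thickening hδ _)
  filter_upwards [hu.eventually hopen] with p hp
  exact hp.trans (Metric.thickening_subset_cthickening _ _)

lemma exists_eventually_subset_closedBall (hF : ∀ y, UpperHemicontinuousAt F y)
    (hFb : ∀ y, Bornology.IsBounded (F y))
    (hu : ∀ t ∈ Icc 0 T,
      Tendsto (fun p : ι × ℝ => u p.1 p.2) (l ×ˢ 𝓝[Icc 0 T] t) (𝓝 (μ t))) :
    ∃ C : NNReal, ∀ᶠ n in l, ∀ t ∈ Icc 0 T, F (u n t) ⊆ Metric.closedBall 0 C := by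
  refine isCompact_Icc.induction_on
    (p := fun s => ∃ C : NNReal, ∀ᶠ n in l, ∀ t ∈ s, F (u n t) ⊆ Metric.closedBall 0 C)
    ⟨0, by simp⟩ ?_ ?_ fun t ht => ?_
  · rintro s s' hss' ⟨C, hC⟩
    exact ⟨C, hC.mono fun n hn t ht => hn t (hss' ht)⟩
  · rintro s s' ⟨C, hC⟩ ⟨C', hC'⟩
    refine ⟨max C C', (hC.and hC').mono fun n hn t ht => ?_⟩
    rcases ht with ht | ht
    · exact (hn.1 t ht).trans (Metric.closedBall_subset_closedBall (by simp))
    · exact (hn.2 t ht).trans (Metric.closedBall_subset_closedBall (by simp))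
  · obtain ⟨C, hC⟩ := (hFb (μ t)).cthickening (δ := 1) |>.subset_closedBall 0
    obtain ⟨pn, hpn, ps, hps, hsub⟩ :=
      eventually_prod_iff.1 (eventually_subset_cthickening hF (hu t ht) one_pos)
    refine ⟨_, hps, C.toNNReal, hpn.mono fun n hn s hs => (hsub hn hs).trans (hC.trans ?_)⟩
    exact Metric.closedBall_subset_closedBall (Real.le_coe_toNNReal C)

variable [l.NeBot]

lemma mem_of_hasDerivAt_of_tendsto (hF : ∀ y, UpperHemicontinuousAt F y)
    (hFconv : ∀ y, Convex ℝ (F y)) (hFc : ∀ y, IsClosed (F y)) {t D : ℝ} (ht : t ∈ Ioo 0 T)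
    (hu : Tendsto (fun p : ι × ℝ => u p.1 p.2) (l ×ˢ 𝓝[Icc 0 T] t) (𝓝 (μ t)))
    (hf : ∀ n, SolvesInclusion T (fun s => F (u n s)) (f n))
    (hlim : ∀ s ∈ Icc 0 T, Tendsto (fun n => f n s) l (𝓝 (f₀ s))) (hD : HasDerivAt f₀ D t) :
    D ∈ F (μ t) := by
  have hnhds : 𝓝[Icc 0 T] t = 𝓝 t := nhdsWithin_eq_nhds.2 (Icc_mem_nhds ht.1 ht.2)
  have htI : t ∈ Icc 0 T := Ioo_subset_Icc_self ht
  rw [← (hFc (μ t)).closure_eq, Metric.closure_eq_iInter_cthickening, mem_iInter₂]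
  intro δ hδ
  obtain ⟨pn, hpn, ps, hps, hsub⟩ :=
    eventually_prod_iff.1 (eventually_subset_cthickening hF hu hδ)
  rw [hnhds] at hps
  have hIcc : ∀ᶠ b in 𝓝[>] t, ∀ s ∈ Icc t b, ps s :=
    (tendsto_nhdsWithin_of_tendsto_nhds (tendsto_const_nhds.Icc tendsto_id)).eventually
      hps.smallSets
  refine Metric.isClosed_cthickening.mem_of_tendsto
    ((hasDerivWithinAt_iff_tendsto_slope' self_notMem_Ioi).1 hD.hasDerivWithinAt) ?_
  filter_upwards [hIcc, Ioo_mem_nhdsGT ht.2] with b hb htb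
  have hbI : b ∈ Icc 0 T := ⟨htI.1.trans htb.1.le, htb.2.le⟩
  refine Metric.isClosed_cthickening.mem_of_tendsto (b := l) (f := fun n => slope (f n) t b) ?_ ?_
  · exact ((hlim b hbI).sub (hlim t htI)).const_smul _
  · filter_upwards [hpn] with n hn
    exact (hf n).slope_mem htI hbI htb.1 ((hFconv _).cthickening δ) Metric.isClosed_cthickening
      fun s hs => hsub hn (hb s hs)

theorem SolvesInclusion.of_tendsto (hT : 0 ≤ T) (hF : ∀ y, UpperHemicontinuousAt F y)
    (hFconv : ∀ y, Convex ℝ (F y)) (hFcomp : ∀ y, IsCompact (F y))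
    (hu : ∀ t ∈ Icc 0 T,
      Tendsto (fun p : ι × ℝ => u p.1 p.2) (l ×ˢ 𝓝[Icc 0 T] t) (𝓝 (μ t)))
    (hf : ∀ n, SolvesInclusion T (fun t => F (u n t)) (f n))
    (hlim : ∀ t ∈ Icc 0 T, Tendsto (fun n => f n t) l (𝓝 (f₀ t))) :
    SolvesInclusion T (fun t => F (μ t)) f₀ := by
  obtain ⟨C, hC⟩ := exists_eventually_subset_closedBall hF (fun y => (hFcomp y).isBounded) hu
  have hlip : LipschitzOnWith C f₀ (Icc 0 T) :=
    lipschitzOnWith_of_tendsto (hC.mono fun n hn => (hf n).lipschitzOnWith hn) hlim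
  have hac : AbsolutelyContinuousOnInterval f₀ 0 T :=
    LipschitzOnWith.absolutelyContinuousOnInterval (by rwa [uIcc_of_le hT])
  refine ⟨hac, ?_⟩
  rw [← Measure.restrict_congr_set Ioo_ae_eq_Icc]
  filter_upwards [ae_restrict_of_ae hac.ae_differentiableAt, ae_restrict_mem measurableSet_Ioo]
    with t hd ht
  have htI : t ∈ Icc 0 T := Ioo_subset_Icc_self ht
  have hderiv := (hd (by rwa [uIcc_of_le hT])).hasDerivAt
  exact ⟨_, mem_of_hasDerivAt_of_tendsto hF hFconv (fun y => (hFcomp y).isClosed) ht (hu t htI) hf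
    hlim hderiv, hderiv.hasDerivWithinAt⟩

end ScalarInclusions

section Curves

variable {X : Type*} [NormedAddCommGroup X] [MeasurableSpace X] [BorelSpace X]
  [SecondCountableTopology X] [CompleteSpace X] {T : ℝ}

lemma W2Continuous.continuous {f : P2 X → ℝ} (hf : W2Continuous f) : Continuous f :=
  continuous_iff_seqContinuous.2 fun u m h => hf u m (tendsto_iff_edist_tendsto_0.1 h)

lemma w2ContinuousOn_iff_continuousOn {μ : ℝ → P2 X} :
    W2ContinuousOn T μ ↔ ContinuousOn μ (Icc 0 T) :=
  forall₂_congr fun s _ => (tendsto_iff_edist_tendsto_0 (f := μ) (y := μ s)).symm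

lemma w2LipschitzOn_iff_lipschitzOnWith {L : NNReal} {μ : ℝ → P2 X} :
    W2LipschitzOn L T μ ↔ LipschitzOnWith L μ (Icc 0 T) :=
  ⟨fun h _ hs _ ht => h _ hs _ ht, fun h _ hs _ ht => h hs ht⟩

lemma tendstoUniformlyOn_of_tendsto_iSup_edist {α β ι : Type*} [PseudoEMetricSpace β]
    {l : Filter ι} {s : Set α} {u : ι → α → β} {μ : α → β}
    (h : Tendsto (fun n => ⨆ t ∈ s, edist (u n t) (μ t)) l (𝓝 0)) :
    TendstoUniformlyOn u μ l s := by
  refine EMetric.tendstoUniformlyOn_iff.2 fun ε hε => ?_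
  filter_upwards [h.eventually_lt_const hε] with n hn t ht
  rw [edist_comm]
  exact (le_iSup₂ (f := fun t _ => edist (u n t) (μ t)) t ht).trans_lt hn

lemma tendsto_prod_nhdsWithin_of_tendstoUniformlyOn {α β ι : Type*} [TopologicalSpace α]
    [UniformSpace β] {l : Filter ι} {s : Set α} {u : ι → α → β} {μ : α → β}
    (h : TendstoUniformlyOn u μ l s) (hμ : ContinuousOn μ s) {t : α} (ht : t ∈ s) :
    Tendsto (fun p : ι × α => u p.1 p.2) (l ×ˢ 𝓝[s] t) (𝓝 (μ t)) :=
  TendstoUniformlyOn.tendsto_comp (F := fun p : ι × α => u p.1)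
    (fun v hv => tendsto_fst.eventually (h v hv)) (hμ t ht) tendsto_snd

lemma P2.continuous_integral {φ : X → ℝ} (hφ : Continuous φ) (hφc : HasCompactSupport φ) :
    Continuous fun μ : P2 X => ∫ x, φ x ∂μ.toMeasure := by
  obtain ⟨C, hC⟩ := hφ.bounded_above_of_compact_support hφc
  exact (ProbabilityMeasure.continuous_integral_boundedContinuousFunction
    (BoundedContinuousFunction.ofNormedAddCommGroup φ hφ C hC)).comp P2.continuous_toProb

lemma mem_sol_iff {d N : ℕ} {lam : P2 (Space d) → ℝ} {μ : ℝ → P2 (Ensemble d N)} :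
    μ ∈ Sol lam T ↔ ContinuousOn μ (Icc 0 T) ∧
      ∀ φ : Ensemble d N → ℝ, ContDiff ℝ ∞ φ → HasCompactSupport φ →
        SolvesInclusion T (fun t => pairings lam φ (μ t)) fun t => ∫ x, φ x ∂(μ t).toMeasure := by
  simp only [Sol, mem_ofPred_eq, w2ContinuousOn_iff_continuousOn, SolvesInclusion, pairings,
    exists_mem_image]

end Curves

end ConsensusMDI

open ConsensusMDI

theorem theorem3p6_general {d N : ℕ} {T : ℝ} (hT : 0 ≤ T) {lam : P2 (Space d) → ℝ}
    (hlam_cont : W2Continuous lam) (hlam_pos : ∀ m, 0 < lam m)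
    {u : ℕ → ℝ → P2 (Ensemble d N)} {μ : ℝ → P2 (Ensemble d N)} (hu : ∀ n, u n ∈ Sol lam T)
    (hconv : Tendsto (fun n => ⨆ t ∈ Icc (0 : ℝ) T, W2 (u n t) (μ t)) atTop (𝓝 0)) :
    μ ∈ Sol lam T ∧
      ∀ L : NNReal, (∀ n, W2LipschitzOn L T (u n)) → W2LipschitzOn L T μ := by
  simp only [mem_sol_iff, w2LipschitzOn_iff_lipschitzOnWith] at hu ⊢
  have hlam := hlam_cont.continuous
  have hunif : TendstoUniformlyOn u μ atTop (Icc 0 T) :=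
    tendstoUniformlyOn_of_tendsto_iSup_edist hconv
  have hμ : ContinuousOn μ (Icc 0 T) :=
    hunif.continuousOn (Frequently.of_forall fun n => (hu n).1)
  refine ⟨⟨hμ, fun φ hφ hφc => ?_⟩, fun L hL =>
    lipschitzOnWith_of_tendsto (.of_forall hL) fun t ht => hunif.tendsto_at ht⟩
  have hφ₁ : ContDiff ℝ 1 φ := hφ.of_le (by simp)
  exact .of_tendsto hT (upperHemicontinuousAt_pairings hlam hlam_pos hφ₁ hφc)
    (convex_pairings hlam hlam_pos hφ₁ hφc) (isCompact_pairings hlam hlam_pos hφ₁ hφc)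
    (fun t ht => tendsto_prod_nhdsWithin_of_tendstoUniformlyOn hunif hμ ht)
    (fun n => (hu n).2 φ hφ hφc)
    fun t ht => ((P2.continuous_integral hφ.continuous hφc).tendsto _).comp (hunif.tendsto_at ht)

theorem theorem3p6 (d N : ℕ) (T : ℝ) (hT : 0 < T)
    (lam : ConsensusMDI.P2 (ConsensusMDI.Space d) → ℝ)
    (hlam_cont : ConsensusMDI.W2Continuous lam)
    (hlam_pos : ∀ m, 0 < lam m)
    (hlam_bdd : ∃ C : ℝ, ∀ m, lam m ≤ C)
    (u : ℕ → ℝ → ConsensusMDI.P2 (ConsensusMDI.Ensemble d N))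
    (μ : ℝ → ConsensusMDI.P2 (ConsensusMDI.Ensemble d N))
    (hu : ∀ n, u n ∈ ConsensusMDI.Sol lam T)
    (hconv : Tendsto (fun n => ⨆ t ∈ Icc (0 : ℝ) T, ConsensusMDI.W2 (u n t) (μ t))
      atTop (𝓝 0)) :
    μ ∈ ConsensusMDI.Sol lam T ∧
      ∀ L : NNReal, (∀ n, ConsensusMDI.W2LipschitzOn L T (u n)) →
        ConsensusMDI.W2LipschitzOn L T μ :=
  theorem3p6_general hT.le hlam_cont hlam_pos hu hconv
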